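/- Let $n$ and $r$ be integers with $0\le r\le n$, and let $[n]=\{1,\dots,n\}$. Let $A^*(U_{n,n})$ be the Chow ring of the free matroid $U_{n,n}$ on $[n]$ (the permutohedral Chow ring), i.e. the quotient of the polynomial ring $\mathbb{Z}[x_S : \emptyset\neq S\subseteq[n]]$ by the ideal generated by the products $x_Sx_T$ with $S\not\subseteq T$ and $T\not\subseteq S$ and by the sums $\sum_{S\ni e}x_S$ for $e\in[n]$. The symmetric group $S_n$ acts on it by ring automorphisms with $\sigma(x_S)=x_{\sigma(S)}$. For a matroid $M$ on $[n]$ with rank function $\mathrm{rank}$, the rank-nullity ring $R^*(M)$ is the subring of $A^*(U_{n,n})$ generated by the elements $$y_{i,j}=\sum_{\substack{\emptyset\neq S\subseteq[n]\\ \mathrm{rank}(S)=i,\ |S|-\mathrm{rank}(S)=j}}x_S,\qquad 0\le i,j\le n.$$ Let $U_{r,n}$ be the uniform matroid of rank $r$ on $[n]$, whose independent sets are the subsets of $[n]$ with at most $r$ elements. Then $$R^*(U_{r,n})=A^*(U_{n,n})^{S_n},$$ the subring of $S_n$-invariant elements of $A^*(U_{n,n})$, and this ring is generated, as a subring of $A^*(U_{n,n})$,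 by the elements $z_l=\sum_{S\subseteq[n],\ |S|=l}x_S$ for $1\le l\le n$. -/

import Mathlib

noncomputable section

namespace RankNullity

/-- The uniform matroid `U_{r,n}` on the ground set `Fin n`: a set is
independent if and only if it has at most `r` elements. -/
def uniformMatroid (r n : ℕ) : Matroid (Fin n) :=
  (IndepMatroid.ofFinite (E := Set.univ) Set.finite_univ (fun I => I.ncard ≤ r)
    (by simp)
    (fun _ _ hJ hIJ => (Set.ncard_le_ncard hIJ).trans hJ)
    (fun I J _ hJ hlt => by
      obtain ⟨e, heJ, heI⟩ := Set.exists_mem_notMem_of_ncard_lt_ncard hlt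
      refine ⟨e, heJ, heI, ?_⟩
      rw [Set.ncard_insert_of_notMem heI]
      omega)
    (fun _ _ => Set.subset_univ _)).matroid

theorem uniformMatroid_ground (r n : ℕ) : (uniformMatroid r n).E = Set.univ := rfl

theorem uniformMatroid_indep (r n : ℕ) (I : Set (Fin n)) :
    (uniformMatroid r n).Indep I ↔ I.ncard ≤ r := Iff.rfl

/-- Every subset is a flat of the free matroid `U_{n,n}`. -/
theorem isFlat_uniformMatroid_self (n : ℕ) (S : Set (Fin n)) :
    (uniformMatroid n n).IsFlat S := by
  have h : uniformMatroid n n = Matroid.freeOn Set.univ := by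
    rw [Matroid.eq_freeOn_iff]
    refine ⟨rfl, ?_⟩
    rw [uniformMatroid_indep]
    exact (Set.ncard_univ (Fin n)).le.trans (Nat.card_fin n).le
  rw [h]
  refine ⟨fun I X hI hX => ?_, Set.subset_univ _⟩
  rw [Matroid.freeOn_isBasis_iff] at hI hX
  exact (hX.1.symm.trans hI.1).subset

/-! ### The Chow ring of a matroid -/

/-- The nonempty flats of a matroid. -/
abbrev NonemptyFlat {α : Type*} (M : Matroid α) : Type _ :=
  {F : Set α // M.IsFlat F ∧ F.Nonempty}

instance {α : Type*} [Finite α] (M : Matroid α) : Fintype (NonemptyFlat M) :=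
  Fintype.ofFinite _

open scoped Classical in
/-- The ideal of relations of the Chow ring: `x_F x_F'` for incomparable nonempty flats `F`, `F'`,
and `∑_{F ∋ e} x_F` for each element `e` of the ground set. -/
def chowIdeal {α : Type*} [Finite α] (M : Matroid α) : Ideal (MvPolynomial (NonemptyFlat M) ℤ) :=
  Ideal.span
    ({p | ∃ F F' : NonemptyFlat M, ¬ F.1 ⊆ F'.1 ∧ ¬ F'.1 ⊆ F.1 ∧
        p = MvPolynomial.X F * MvPolynomial.X F'} ∪
      {p | ∃ e ∈ M.E, p = ∑ F : NonemptyFlat M with e ∈ F.1, MvPolynomial.X F})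

/-- The Chow ring `A^*(M)` of a matroid `M`. -/
abbrev ChowRing {α : Type*} [Finite α] (M : Matroid α) : Type _ :=
  MvPolynomial (NonemptyFlat M) ℤ ⧸ chowIdeal M

/-- The permutohedral Chow ring `A^*(U_{n,n})`. -/
abbrev PermutohedralChowRing (n : ℕ) : Type :=
  ChowRing (uniformMatroid n n)

/-- The generator `x_S` of `A^*(U_{n,n})` for a nonempty subset `S`. -/
def x {n : ℕ} (S : Set (Fin n)) (hS : S.Nonempty) : PermutohedralChowRing n :=
  Ideal.Quotient.mk (chowIdeal (uniformMatroid n n))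
    (MvPolynomial.X ⟨S, isFlat_uniformMatroid_self n S, hS⟩)

/-! ### The rank-nullity ring -/

/-- The rank function of a matroid on `Fin n`, with values in `ℕ`. -/
def rank {n : ℕ} (M : Matroid (Fin n)) (S : Set (Fin n)) : ℕ := (M.eRk S).toNat

/-- The nullity `|S| - rank S`; the subtraction never truncates because `rank S ≤ |S|`. -/
def nullity {n : ℕ} (M : Matroid (Fin n)) (S : Set (Fin n)) : ℕ := S.ncard - rank M S

open scoped Classical in
/-- `y_{i,j}`, the sum of `x_S` over the nonempty `S` of rank `i` and nullity `j` in `M`. -/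
def y {n : ℕ} (M : Matroid (Fin n)) (i j : ℕ) : PermutohedralChowRing n :=
  ∑ S : {S : Set (Fin n) // S.Nonempty ∧ rank M S = i ∧ nullity M S = j}, x S.1 S.2.1

/-- The rank-nullity ring `R^*(M) = ℤ[y_{i,j} : 0 ≤ i, j ≤ n]`, a subring of `A^*(U_{n,n})`. -/
def rankNullityRing {n : ℕ} (M : Matroid (Fin n)) : Subring (PermutohedralChowRing n) :=
  Subring.closure {f | ∃ i j : ℕ, i ≤ n ∧ j ≤ n ∧ f = y M i j}

open scoped Classical in
/-- `z_l`, the sum of `x_S` over the nonempty `S` with `l` elements. -/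
def z (n l : ℕ) : PermutohedralChowRing n :=
  ∑ S : {S : Set (Fin n) // S.Nonempty ∧ S.ncard = l}, x S.1 S.2.1

/-! ### The action of the symmetric group on `A^*(U_{n,n})`, with `σ x_S = x_{σ(S)}` -/

/-- A permutation acts on the nonempty subsets (the nonempty flats of `U_{n,n}`) by `S ↦ σ(S)`. -/
def permFlat {n : ℕ} (σ : Equiv.Perm (Fin n)) (F : NonemptyFlat (uniformMatroid n n)) :
    NonemptyFlat (uniformMatroid n n) :=
  ⟨σ '' F.1, isFlat_uniformMatroid_self n _, F.2.2.image σ⟩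

theorem permFlat_one {n : ℕ} (F : NonemptyFlat (uniformMatroid n n)) : permFlat 1 F = F :=
  Subtype.ext (by simp [permFlat])

theorem permFlat_mul {n : ℕ} (σ τ : Equiv.Perm (Fin n)) (F : NonemptyFlat (uniformMatroid n n)) :
    permFlat (σ * τ) F = permFlat σ (permFlat τ F) :=
  Subtype.ext (by simp [permFlat, Set.image_image])

theorem chowIdeal_le_comap {n : ℕ} (σ : Equiv.Perm (Fin n)) :
    chowIdeal (uniformMatroid n n) ≤ (chowIdeal (uniformMatroid n n)).comap
      (MvPolynomial.rename (R := ℤ) (permFlat σ)).toRingHom := by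
  classical
  conv_lhs => rw [chowIdeal]
  rw [Ideal.span_le]
  rintro p (⟨F, F', h, h', rfl⟩ | ⟨e, -, rfl⟩)
  · refine Ideal.subset_span (Or.inl ⟨permFlat σ F, permFlat σ F', ?_, ?_, by simp⟩)
    · simpa [permFlat, Set.image_subset_image_iff σ.injective] using h
    · simpa [permFlat, Set.image_subset_image_iff σ.injective] using h'
  · refine Ideal.subset_span (Or.inr ⟨σ e, Set.mem_univ _, ?_⟩)
    simp only [AlgHom.toRingHom_eq_coe, RingHom.coe_coe, map_sum, MvPolynomial.rename_X]
    refine Finset.sum_bij' (fun F _ => permFlat σ F) (fun F _ => permFlat σ⁻¹ F) ?_ ?_ ?_ ?_ ?_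
    · intro F hF
      simpa [permFlat] using hF
    · intro F hF
      simp only [Finset.mem_filter, Finset.mem_univ, true_and] at hF ⊢
      exact ⟨σ e, hF, by simp⟩
    · intro F _
      rw [← permFlat_mul, inv_mul_cancel, permFlat_one]
    · intro F _
      rw [← permFlat_mul, mul_inv_cancel, permFlat_one]
    · intro F _
      rfl

/-- The ring endomorphism of `A^*(U_{n,n})` with `x_S ↦ x_{σ(S)}`. -/
def permHom {n : ℕ} (σ : Equiv.Perm (Fin n)) :
    PermutohedralChowRing n →+* PermutohedralChowRing n :=
  Ideal.quotientMap (chowIdeal (uniformMatroid n n))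
    (MvPolynomial.rename (R := ℤ) (permFlat σ)).toRingHom (chowIdeal_le_comap σ)

theorem permHom_mk {n : ℕ} (σ : Equiv.Perm (Fin n))
    (p : MvPolynomial (NonemptyFlat (uniformMatroid n n)) ℤ) :
    permHom σ (Ideal.Quotient.mk _ p) =
      Ideal.Quotient.mk _ (MvPolynomial.rename (permFlat σ) p) := rfl

/-- The action of `S_n` on `A^*(U_{n,n})` by ring automorphisms. -/
instance permAction (n : ℕ) :
    MulSemiringAction (Equiv.Perm (Fin n)) (PermutohedralChowRing n) where
  smul σ f := permHom σ f
  one_smul f := by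
    obtain ⟨p, rfl⟩ := Ideal.Quotient.mk_surjective f
    change permHom 1 _ = _
    rw [permHom_mk, show permFlat (1 : Equiv.Perm (Fin n)) = id from funext permFlat_one,
      MvPolynomial.rename_id_apply]
  mul_smul σ τ f := by
    obtain ⟨p, rfl⟩ := Ideal.Quotient.mk_surjective f
    change permHom (σ * τ) _ = permHom σ (permHom τ _)
    rw [permHom_mk, permHom_mk, permHom_mk, MvPolynomial.rename_rename,
      show permFlat (σ * τ) = permFlat σ ∘ permFlat τ from funext (permFlat_mul σ τ)]
  smul_zero σ := map_zero (permHom σ)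
  smul_add σ := map_add (permHom σ)
  smul_one σ := map_one (permHom σ)
  smul_mul σ := map_mul (permHom σ)

theorem perm_smul_x {n : ℕ} (σ : Equiv.Perm (Fin n)) (S : Set (Fin n)) (hS : S.Nonempty) :
    σ • x S hS = x (σ '' S) (hS.image σ) := by
  change permHom σ (Ideal.Quotient.mk _ _) = _
  rw [permHom_mk, MvPolynomial.rename_X]
  rfl

end RankNullity

end

/-! The Chow ring has the Feichtner–Yuzvinsky `ℤ`-basis: monomials `x_{S_1}^{a_1} ⋯ x_{S_k}^{a_k}`
along chains `S_1 ⊂ ⋯ ⊂ S_k` with `0 < a_i < |S_i| - |S_{i-1}|`, where `S_0 = ∅`. The condition sees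
only cardinalities, so `S_n` permutes this basis, and two members share an orbit exactly when their
sizes and exponents agree (`exists_perm_mapDomain`). Invariants are thus integer combinations of
orbit sums. An orbit sum is `∏ z_{|S_i|}^{a_i}` (`prod_z_pow`): distinct sets of equal size are
incomparable, so a power of `z_l` is the sum of the powers, and only chains survive in the product.
In a uniform matroid, size and the pair (rank, nullity) determine each other, so each `y_{i,j}` is
some `z_l` or zero.

Most of the work is the basis. Spanning is a descent that pushes monomials towards larger sets
(`mon_mem_span_normal`). For independence, a recursion bounds the number of normal monomials by
`n!`. The polynomial ring in the `x_S` is mapped to `n!` copies of `ℤ[t_1, …, t_n]`, one per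
complete flag. By Nakayama's lemma the images of the normal monomials span after inverting a
polynomial with constant term `1`; being at most `n!` in number, they are independent, and reduction
at the origin gives independence in the Chow ring. -/

namespace RankNullity

open MvPolynomial

/-! ### Monomials and the chain relations -/

/-- The nonempty subsets of `Fin n`, as flats of the free matroid. -/
abbrev Flat (n : ℕ) : Type := NonemptyFlat (uniformMatroid n n)

/-- The class of a monomial in the permutohedral Chow ring. -/
noncomputable def mon {n : ℕ} (m : Flat n →₀ ℕ) : PermutohedralChowRing n :=
  Ideal.Quotient.mk _ (monomial m 1)

/-- The generator attached to a nonempty subset. -/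
noncomputable def gen {n : ℕ} (S : Flat n) : PermutohedralChowRing n :=
  mon (Finsupp.single S 1)

theorem x_eq_gen {n : ℕ} (S : Set (Fin n)) (hS : S.Nonempty) :
    x S hS = gen ⟨S, isFlat_uniformMatroid_self n S, hS⟩ := rfl

theorem mon_zero {n : ℕ} : mon (0 : Flat n →₀ ℕ) = 1 := rfl

theorem mon_add {n : ℕ} (m m' : Flat n →₀ ℕ) : mon (m + m') = mon m * mon m' := by
  rw [mon, mon, mon, ← map_mul, monomial_mul, one_mul]

theorem mon_single {n : ℕ} (S : Flat n) (a : ℕ) : mon (Finsupp.single S a) = gen S ^ a := by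
  rw [gen, mon, mon, ← map_pow, monomial_pow]
  simp

theorem gen_mul_gen {n : ℕ} {S T : Flat n} (h : ¬ S.1 ⊆ T.1) (h' : ¬ T.1 ⊆ S.1) :
    gen S * gen T = 0 := by
  rw [gen, gen, mon, mon, ← map_mul]
  exact Ideal.Quotient.eq_zero_iff_mem.2 (Ideal.subset_span (Or.inl ⟨S, T, h, h', rfl⟩))

theorem mon_eq_mul_of_le {n : ℕ} {m m' : Flat n →₀ ℕ} (h : m' ≤ m) :
    mon m = mon (m - m') * mon m' := by
  rw [← mon_add, tsub_add_cancel_of_le h]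

theorem mon_mul_gen {n : ℕ} {m : Flat n →₀ ℕ} {S T : Flat n} (hS : S ∈ m.support)
    (h : ¬ S.1 ⊆ T.1) (h' : ¬ T.1 ⊆ S.1) : mon m * gen T = 0 := by
  have h1 : Finsupp.single S 1 ≤ m := by
    rw [Finsupp.single_le_iff]
    exact Nat.one_le_iff_ne_zero.2 (Finsupp.mem_support_iff.1 hS)
  rw [mon_eq_mul_of_le h1, mul_assoc, ← gen, gen_mul_gen h h', mul_zero]

/-- The support of an exponent vector is a chain of subsets. -/
def ChainSupp {n : ℕ} (m : Flat n →₀ ℕ) : Prop :=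
  ∀ S ∈ m.support, ∀ T ∈ m.support, S.1 ⊆ T.1 ∨ T.1 ⊆ S.1

theorem mon_eq_zero {n : ℕ} {m : Flat n →₀ ℕ} (h : ¬ ChainSupp m) : mon m = 0 := by
  simp only [ChainSupp, not_forall, not_or] at h
  obtain ⟨S, hS, T, hT, h1, h2⟩ := h
  have hle : Finsupp.single T 1 ≤ m := by
    rw [Finsupp.single_le_iff]
    exact Nat.one_le_iff_ne_zero.2 (Finsupp.mem_support_iff.1 hT)
  rw [mon_eq_mul_of_le hle]
  refine mon_mul_gen (S := S) ?_ h1 h2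
  have hne : T ≠ S := by rintro rfl; exact h1 subset_rfl
  simpa [Finsupp.single_apply, hne] using hS

/-! ### Superset sums and their vanishing powers -/

open scoped Classical in
/-- The sum of the generators attached to the supersets of `T`. -/
noncomputable def upSum {n : ℕ} (T : Set (Fin n)) : PermutohedralChowRing n :=
  ∑ U : Flat n with T ⊆ U.1, gen U

open scoped Classical in
theorem sum_gen_mem {n : ℕ} (e : Fin n) : ∑ U : Flat n with e ∈ U.1, gen U = 0 := by
  have : (∑ U : Flat n with e ∈ U.1, gen U) = Ideal.Quotient.mk (chowIdeal (uniformMatroid n n))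
      (∑ U : Flat n with e ∈ U.1, X U) := by
    rw [map_sum]; rfl
  rw [this]
  exact Ideal.Quotient.eq_zero_iff_mem.2 (Ideal.subset_span (Or.inr ⟨e, Set.mem_univ _, rfl⟩))

open scoped Classical in
theorem upSum_add_eq_zero {n : ℕ} {T : Set (Fin n)} {e : Fin n} (he : e ∈ T) :
    upSum T + ∑ U : Flat n with e ∈ U.1 ∧ ¬ T ⊆ U.1, gen U = 0 := by
  have h := sum_gen_mem e
  rw [← Finset.sum_filter_add_sum_filter_not _ (fun U : Flat n => T ⊆ U.1),
    Finset.filter_filter, Finset.filter_filter] at h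
  rw [← h, upSum]
  congr 2
  ext U
  simp only [Finset.mem_filter, Finset.mem_univ, true_and]
  exact ⟨fun h => ⟨h he, h⟩, fun h => h.2⟩

/-- Only sets `V ⊇ T` comparable to `U` contribute, and `V ⊆ U` would force `T ⊆ U`; hence `V ⊇ U`.
-/
theorem gen_mul_upSum {n : ℕ} {U : Flat n} {T : Set (Fin n)} (h : ¬ T ⊆ U.1) :
    gen U * upSum T = gen U * upSum (T ∪ U.1) := by
  classical
  rw [upSum, upSum, Finset.mul_sum, Finset.mul_sum]
  symm
  refine Finset.sum_subset ?_ ?_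
  · intro V hV
    simp only [Finset.mem_filter, Finset.mem_univ, true_and] at hV ⊢
    exact Set.subset_union_left.trans hV
  · intro V hV hV'
    simp only [Finset.mem_filter, Finset.mem_univ, true_and] at hV hV'
    refine gen_mul_gen (fun hUV => hV' (Set.union_subset hV hUV)) (fun hVU => h (hV.trans hVU))

theorem mul_pow_congr {R : Type*} [CommRing R] {a b c : R} (h : a * b = a * c) (d : ℕ) :
    a * b ^ d = a * c ^ d := by
  induction d with
  | zero => simp
  | succ d ih => rw [pow_succ, ← mul_assoc, ih, mul_right_comm, h, mul_right_comm, mul_assoc, pow_succ]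

theorem mul_mul_eq_zero_of_add {R : Type*} [CommRing R] {a b c s : R} (h : b + s = 0)
    (h' : a * s * c = 0) : a * b * c = 0 := by
  rw [eq_neg_of_add_eq_zero_left h, mul_neg, neg_mul, h', neg_zero]

/-- Pick `e ∈ T \ S`. The linear relation at `e` trades one factor `upSum T` for generators of sets
`U ∋ e` not containing `T`. If `U ⊉ S`, then `U` is incomparable to `S` and `a` kills it. If `U ⊇
S`, the remaining factors become `upSum (T ∪ U)`, and induction applies to `U ⊂ T ∪ U`, whose
difference `T \ U` has lost `e`. -/
theorem mul_upSum_pow_eq_zero {n : ℕ} (d : ℕ) : ∀ (S T : Set (Fin n)) (a : PermutohedralChowRing n),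
    (∀ U : Flat n, ¬ S ⊆ U.1 → ¬ U.1 ⊆ S → a * gen U = 0) → S ⊂ T → (T \ S).ncard ≤ d →
    a * upSum T ^ d = 0 := by
  classical
  induction d with
  | zero =>
    intro S T a _ hST hd
    rw [Nat.le_zero, Set.ncard_eq_zero (Set.toFinite _), Set.sdiff_eq_empty] at hd
    exact absurd hd hST.2
  | succ d ih =>
    intro S T a ha hST hd
    obtain ⟨e, heT, heS⟩ := Set.exists_of_ssubset hST
    rw [pow_succ', ← mul_assoc]
    refine mul_mul_eq_zero_of_add (upSum_add_eq_zero heT) ?_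
    rw [Finset.mul_sum, Finset.sum_mul]
    refine Finset.sum_eq_zero fun U hU => ?_
    simp only [Finset.mem_filter, Finset.mem_univ, true_and] at hU
    by_cases hSU : S ⊆ U.1
    · rw [mul_assoc, mul_pow_congr (gen_mul_upSum hU.2)]
      rw [ih U.1 (T ∪ U.1) (gen U) (fun V h1 h2 => gen_mul_gen h1 h2), mul_zero]
      · exact ⟨Set.subset_union_right, fun h => hU.2 (Set.subset_union_left.trans h)⟩
      · rw [Set.union_sdiff_right]
        have hlt : (T \ U.1).ncard < (T \ S).ncard := by
          refine Set.ncard_lt_ncard ⟨Set.sdiff_subset_sdiff_right hSU, fun h => ?_⟩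
          exact (h ⟨heT, heS⟩).2 hU.1
        omega
    · rw [ha U hSU (fun h => heS (h hU.1)), zero_mul]

/-! ### Normal monomials span -/

/-- Exponent vectors of the Feichtner–Yuzvinsky basis. -/
def IsNormal {n : ℕ} (m : Flat n →₀ ℕ) : Prop :=
  ChainSupp m ∧ (∀ T ∈ m.support, m T < T.1.ncard) ∧
    ∀ U ∈ m.support, ∀ T ∈ m.support, U.1 ⊂ T.1 → m T + U.1.ncard < T.1.ncard

/-- The total codimension of the subsets in a monomial. -/
noncomputable def codegree {n : ℕ} : (Flat n →₀ ℕ) →+ ℕ :=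
  Finsupp.weight fun S : Flat n => n - S.1.ncard

theorem codegree_single {n : ℕ} (S : Flat n) (a : ℕ) :
    codegree (Finsupp.single S a) = a * (n - S.1.ncard) := by
  simp [codegree, Finsupp.weight_single]

/-- The additive group spanned by the monomials of bounded codegree. -/
noncomputable def filtration (n c : ℕ) : Submodule ℤ (PermutohedralChowRing n) :=
  Submodule.span ℤ (mon '' {m | codegree m ≤ c})

theorem mon_mem_filtration {n c : ℕ} {m : Flat n →₀ ℕ} (h : codegree m ≤ c) :
    mon m ∈ filtration n c := Submodule.subset_span ⟨m, h, rfl⟩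

theorem gen_mem_filtration {n c : ℕ} {S : Flat n} (h : n - S.1.ncard ≤ c) :
    gen S ∈ filtration n c := mon_mem_filtration (by simpa [codegree_single] using h)

theorem mul_mem_filtration {n c d : ℕ} {a b : PermutohedralChowRing n}
    (ha : a ∈ filtration n c) (hb : b ∈ filtration n d) : a * b ∈ filtration n (c + d) := by
  have h : filtration n c * filtration n d ≤ filtration n (c + d) := by
    rw [filtration, filtration, Submodule.span_mul_span, Submodule.span_le]
    rintro _ ⟨_, ⟨m, hm, rfl⟩, _, ⟨m', hm', rfl⟩, rfl⟩
    simp only [Set.mem_ofPred_eq] at hm hm'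
    change mon m * mon m' ∈ _
    rw [← mon_add]
    exact mon_mem_filtration (by rw [map_add]; omega)
  exact h (Submodule.mul_mem_mul ha hb)

theorem pow_mem_filtration {n c : ℕ} {a : PermutohedralChowRing n} (ha : a ∈ filtration n c)
    (k : ℕ) : a ^ k ∈ filtration n (k * c) := by
  induction k with
  | zero => rw [pow_zero, ← mon_zero]; exact mon_mem_filtration (by simp)
  | succ k ih => rw [pow_succ, Nat.succ_mul]; exact mul_mem_filtration ih ha

open scoped Classical in
theorem upSum_sub_gen {n : ℕ} (T : Flat n) :
    upSum T.1 - gen T = ∑ U : Flat n with T.1 ⊂ U.1, gen U := by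
  have h : (Finset.univ.filter fun U : Flat n => T.1 ⊆ U.1) =
      insert T (Finset.univ.filter fun U : Flat n => T.1 ⊂ U.1) := by
    ext U
    simp only [Finset.mem_filter, Finset.mem_univ, true_and, Finset.mem_insert]
    constructor
    · intro h
      rcases h.eq_or_ssubset with h | h
      · exact Or.inl (Subtype.ext h.symm)
      · exact Or.inr h
    · rintro (rfl | h)
      · exact subset_rfl
      · exact h.1
  rw [upSum, h, Finset.sum_insert (by simp), add_sub_cancel_left]
  
theorem upSum_mem_filtration {n : ℕ} (T : Set (Fin n)) :
    upSum T ∈ filtration n (n - T.ncard) := by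
  classical
  refine Submodule.sum_mem _ fun U hU => gen_mem_filtration ?_
  have := Set.ncard_le_ncard (Finset.mem_filter.1 hU).2
  omega

theorem upSum_pow_sub_mem_filtration {n d : ℕ} (T : Flat n) {m : Flat n →₀ ℕ} {c : ℕ} (hd : 0 < d)
    (hc : codegree m + d * (n - T.1.ncard) ≤ c + 1) :
    mon m * (upSum T.1 ^ d - gen T ^ d) ∈ filtration n c := by
  classical
  -- Factor the difference of `d`-th powers: the factor `upSum T - gen T` involves only strict
  -- supersets of `T`, which lowers the codegree by at least one.
  rw [← (Commute.all _ _).mul_geom_sum₂, upSum_sub_gen]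
  by_cases hT : T.1.ncard < n
  · obtain ⟨d, rfl⟩ := Nat.exists_eq_add_of_lt hd
    have h1 : (∑ U : Flat n with T.1 ⊂ U.1, gen U) ∈ filtration n (n - T.1.ncard - 1) := by
      refine Submodule.sum_mem _ fun U hU => gen_mem_filtration ?_
      have := Set.ncard_lt_ncard (Finset.mem_filter.1 hU).2
      omega
    have h2 : (∑ i ∈ Finset.range (0 + d + 1), upSum T.1 ^ i * gen T ^ (0 + d + 1 - 1 - i)) ∈
        filtration n (d * (n - T.1.ncard)) := by
      refine Submodule.sum_mem _ fun i hi => ?_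
      have h3 := mul_mem_filtration (pow_mem_filtration (upSum_mem_filtration T.1) i)
        (pow_mem_filtration (gen_mem_filtration (S := T) le_rfl) (0 + d + 1 - 1 - i))
      rw [← add_mul] at h3
      have h4 := Finset.mem_range.1 hi
      rwa [show i + (0 + d + 1 - 1 - i) = d by omega] at h3
    refine Submodule.span_mono ?_ (mul_mem_filtration (mon_mem_filtration (m := m) le_rfl)
      (mul_mem_filtration h1 h2))
    refine Set.image_mono fun k hk => ?_
    simp only [Set.mem_ofPred_eq] at hk ⊢
    rw [zero_add, Nat.succ_mul] at hc
    omega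
  · rw [Finset.sum_eq_zero, zero_mul, mul_zero]
    · exact Submodule.zero_mem _
    · intro U hU
      have h1 := Set.ncard_lt_ncard (Finset.mem_filter.1 hU).2
      have h2 := Set.ncard_le_ncard (Set.subset_univ U.1)
      rw [Set.ncard_univ, Nat.card_fin] at h2
      omega

theorem exists_reducible {n : ℕ} {m : Flat n →₀ ℕ} (hc : ChainSupp m) (hm : ¬ IsNormal m) :
    ∃ (T : Flat n) (S : Set (Fin n)), S ⊂ T.1 ∧ (T.1 \ S).ncard ≤ m T ∧
      ((S = ∅) ∨ ∃ U ∈ m.support, U.1 = S) := by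
  by_cases h : ∀ T ∈ m.support, m T < T.1.ncard
  · have hm' : ¬ ∀ U ∈ m.support, ∀ T ∈ m.support, U.1 ⊂ T.1 → m T + U.1.ncard < T.1.ncard :=
      fun h' => hm ⟨hc, h, h'⟩
    simp only [not_forall] at hm'
    obtain ⟨U, hU, T, hT, hUT, hlt⟩ := hm'
    refine ⟨T, U.1, hUT, ?_, Or.inr ⟨U, hU, rfl⟩⟩
    rw [Set.ncard_sdiff hUT.1]
    omega
  · simp only [not_forall] at h
    obtain ⟨T, hT, hlt⟩ := h
    exact ⟨T, ∅, T.2.2.empty_ssubset, by simpa using hlt, Or.inl rfl⟩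

/-- Induction on codegree. A non-normal chain monomial contains `gen T ^ d` with `d` large enough
that its cofactor kills `upSum T ^ d`. So `gen T ^ d` may be replaced by `gen T ^ d - upSum T ^ d`,
which has smaller codegree. -/
theorem mon_mem_span_normal {n : ℕ} (c : ℕ) : ∀ m : Flat n →₀ ℕ, codegree m < c →
    mon m ∈ Submodule.span ℤ (mon '' {m : Flat n →₀ ℕ | IsNormal m}) := by
  classical
  induction c with
  | zero => intro m h; omega
  | succ c ih =>
    intro m hmc
    by_cases hch : ChainSupp m
    swap
    · rw [mon_eq_zero hch]; exact Submodule.zero_mem _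
    by_cases hm : IsNormal m
    · exact Submodule.subset_span ⟨m, hm, rfl⟩
    obtain ⟨T, S, hST, hd, hS⟩ := exists_reducible hch hm
    set d := (T.1 \ S).ncard with hdd
    have hd0 : 0 < d := by
      rw [hdd, Set.ncard_pos (Set.toFinite _)]
      exact Set.nonempty_of_ssubset hST
    have hle : Finsupp.single T d ≤ m := Finsupp.single_le_iff.2 hd
    set m' := m - Finsupp.single T d with hm'
    have hmm : m = m' + Finsupp.single T d := (tsub_add_cancel_of_le hle).symm
    have hkill : mon m' * upSum T.1 ^ d = 0 := by
      refine mul_upSum_pow_eq_zero d S T.1 _ ?_ hST le_rfl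
      rintro V h1 h2
      rcases hS with rfl | ⟨U, hU, rfl⟩
      · exact absurd (Set.empty_subset _) h1
      · refine mon_mul_gen (S := U) ?_ h1 h2
        have hne : T ≠ U := by rintro rfl; exact hST.2 subset_rfl
        simpa [hm', Finsupp.single_apply, hne] using hU
    have hcod : codegree m = codegree m' + d * (n - T.1.ncard) := by
      conv_lhs => rw [hmm]
      rw [map_add, codegree_single]
    have heq : mon m = -(mon m' * (upSum T.1 ^ d - gen T ^ d)) := by
      rw [mul_sub, hkill, zero_sub, neg_neg, ← mon_single, ← mon_add, ← hmm]
    rw [heq]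
    refine Submodule.neg_mem _ ?_
    -- In codegree zero there is nothing to descend to; there `T` is the whole ground set, which has
    -- no strict supersets, so the difference is zero.
    rcases Nat.eq_zero_or_pos c with rfl | hcpos
    · have h0 : mon m' * (upSum T.1 ^ d - gen T ^ d) = 0 := by
        have hT : ¬ T.1.ncard < n := by
          intro h
          have : 0 < d * (n - T.1.ncard) := Nat.mul_pos hd0 (by omega)
          omega
        rw [← (Commute.all _ _).mul_geom_sum₂, upSum_sub_gen, Finset.sum_eq_zero, zero_mul, mul_zero]
        intro U hU
        have h1 := Set.ncard_lt_ncard (Finset.mem_filter.1 hU).2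
        have h2 := Set.ncard_le_ncard (Set.subset_univ U.1)
        rw [Set.ncard_univ, Nat.card_fin] at h2
        omega
      rw [h0]
      exact Submodule.zero_mem _
    · have h1 := upSum_pow_sub_mem_filtration (c := c - 1) T (m := m') hd0 (by omega)
      refine Submodule.span_le.2 ?_ h1
      rintro _ ⟨k, hk, rfl⟩
      simp only [Set.mem_ofPred_eq] at hk
      exact ih k (by omega)

theorem span_normal_eq_top (n : ℕ) :
    Submodule.span ℤ (mon '' {m : Flat n →₀ ℕ | IsNormal m}) = ⊤ := by
  rw [eq_top_iff]
  rintro f -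
  obtain ⟨p, rfl⟩ := Ideal.Quotient.mk_surjective f
  rw [p.as_sum, map_sum]
  refine Submodule.sum_mem _ fun m _ => ?_
  have h : Ideal.Quotient.mk (chowIdeal (uniformMatroid n n)) (monomial m (coeff m p)) =
      coeff m p • mon m := by
    rw [mon, ← map_zsmul]
    congr 1
    rw [smul_monomial]
    simp
  rw [h]
  exact Submodule.smul_mem _ _ (mon_mem_span_normal _ m (Nat.lt_succ_self _))

/-! ### At most `n!` normal monomials -/

/-- The remainder `k.choose i * (k - i)!` is `k! / i!`, and its successive differences are the
summands. At `j = 0` the truncated `j - 1` is `0`, as needed. -/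
theorem sum_choose_mul_factorial_add (k i : ℕ) (hi : i ≤ k) :
    ∑ j ∈ Finset.range (i + 1), k.choose j * ((k - j).factorial * (j - 1)) +
      k.choose i * (k - i).factorial = k.factorial := by
  induction i with
  | zero => simp
  | succ i ih =>
    rw [← ih (by omega), Finset.sum_range_succ _ (i + 1), add_assoc]
    congr 1
    have h1 := Nat.choose_succ_right_eq k i
    have h2 : (k - i).factorial = (k - i) * (k - (i + 1)).factorial := by
      rw [show k - i = (k - (i + 1)) + 1 by omega, Nat.factorial_succ]
    rw [h2, Nat.add_sub_cancel, ← mul_assoc (k.choose i), ← h1]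
    ring

theorem sum_choose_mul_factorial (k : ℕ) :
    1 + ∑ j ∈ Finset.range (k + 1), k.choose j * ((k - j).factorial * (j - 1)) =
      k.factorial := by
  rw [← sum_choose_mul_factorial_add k k le_rfl]
  simp [add_comm]

/-- The normal exponent vectors supported on strict supersets of `S`, relative to `S`. -/
def NormalAbove {n : ℕ} (S : Set (Fin n)) (m : Flat n →₀ ℕ) : Prop :=
  ChainSupp m ∧ (∀ T ∈ m.support, S ⊂ T.1 ∧ m T + S.ncard < T.1.ncard) ∧
    ∀ U ∈ m.support, ∀ T ∈ m.support, U.1 ⊂ T.1 → m T + U.1.ncard < T.1.ncard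

theorem IsNormal.normalAbove {n : ℕ} {m : Flat n →₀ ℕ} (h : IsNormal m) : NormalAbove ∅ m :=
  ⟨h.1, fun T hT => ⟨T.2.2.empty_ssubset, by simpa using h.2.1 T hT⟩, h.2.2⟩

theorem NormalAbove.exists_min {n : ℕ} {S : Set (Fin n)} {m : Flat n →₀ ℕ}
    (h : NormalAbove S m) (h0 : m ≠ 0) : ∃ T : Flat n, S ⊂ T.1 ∧ NormalAbove T.1 (m.erase T) ∧
      m T ∈ Finset.Ico 1 (T.1.ncard - S.ncard) := by
  obtain ⟨T, hT, hmin⟩ := Finset.exists_min_image m.support (fun T => T.1.ncard)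
    (Finsupp.support_nonempty_iff.2 h0)
  obtain ⟨h1, h2, h3⟩ := h
  have hmem : ∀ U ∈ (m.erase T).support, U ∈ m.support ∧ T.1 ⊂ U.1 := by
    intro U hU
    rw [Finsupp.support_erase, Finset.mem_erase] at hU
    refine ⟨hU.2, ?_⟩
    have hsub : T.1 ⊆ U.1 := by
      rcases h1 T hT U hU.2 with h | h
      · exact h
      · exact (Set.eq_of_subset_of_ncard_le h (hmin U hU.2)).symm.subset
    exact hsub.ssubset_of_ne fun h => hU.1 (Subtype.ext h.symm)
  have hval : ∀ U ∈ (m.erase T).support, m.erase T U = m U := by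
    intro U hU
    rw [Finsupp.support_erase, Finset.mem_erase] at hU
    exact Finsupp.erase_ne hU.1
  refine ⟨T, (h2 T hT).1, ⟨?_, ?_, ?_⟩, ?_⟩
  · exact fun U hU V hV => h1 U (hmem U hU).1 V (hmem V hV).1
  · intro U hU
    rw [hval U hU]
    exact ⟨(hmem U hU).2, h3 T hT U (hmem U hU).1 (hmem U hU).2⟩
  · intro U hU V hV hUV
    rw [hval V hV]
    exact h3 U (hmem U hU).1 V (hmem V hV).1 hUV
  · have := (h2 T hT).2
    have := Finsupp.mem_support_iff.1 hT
    rw [Finset.mem_Ico]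
    omega

open scoped Classical in
theorem sum_ssuperset_le {n : ℕ} (S : Set (Fin n)) (g : ℕ → ℕ) :
    ∑ T : Flat n with S ⊂ T.1, g (T.1.ncard - S.ncard) ≤
      ∑ j ∈ Finset.range (n - S.ncard + 1), (n - S.ncard).choose j * g j := by
  have hc : (Sᶜ).toFinset.card = n - S.ncard := by
    rw [← Set.ncard_eq_toFinset_card', Set.ncard_compl, Nat.card_fin]
  have hpow := Finset.sum_powerset_apply_card (x := (Sᶜ).toFinset) g
  rw [hc] at hpow
  simp only [smul_eq_mul] at hpow
  rw [← hpow]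
  have hinj : Set.InjOn (fun T : Flat n => (T.1 \ S).toFinset)
      (Finset.univ.filter fun T : Flat n => S ⊂ T.1) := by
    intro T hT U hU hTU
    simp only [Finset.coe_filter, Finset.mem_univ, true_and, Set.mem_ofPred_eq] at hT hU
    have h : T.1 \ S = U.1 \ S := Set.toFinset_inj.1 hTU
    apply Subtype.ext
    rw [← Set.sdiff_union_of_subset hT.1, h, Set.sdiff_union_of_subset hU.1]
  have hsum : ∑ T : Flat n with S ⊂ T.1, g (T.1.ncard - S.ncard) =
      ∑ V ∈ (Finset.univ.filter fun T : Flat n => S ⊂ T.1).image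
        (fun T : Flat n => (T.1 \ S).toFinset), g V.card := by
    rw [Finset.sum_image hinj]
    refine Finset.sum_congr rfl fun T hT => ?_
    rw [← Set.ncard_eq_toFinset_card', Set.ncard_sdiff (Finset.mem_filter.1 hT).2.1]
  rw [hsum]
  refine Finset.sum_le_sum_of_subset ?_
  intro V hV
  obtain ⟨T, -, rfl⟩ := Finset.mem_image.1 hV
  rw [Finset.mem_powerset, Set.toFinset_subset_toFinset]
  exact fun i hi => hi.2

/-- A nonzero vector is determined by its smallest set `T`, the exponent there, and a normal vector
above `T`. If `|T \ S| = j`, there are `j - 1` exponents and at most `(k - j)!` continuations;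
`sum_choose_mul_factorial` adds these up to `k!`. -/
theorem exists_finset_normalAbove {n : ℕ} (k : ℕ) : ∀ S : Set (Fin n), n - S.ncard = k →
    ∃ C : Finset (Flat n →₀ ℕ), (∀ m, NormalAbove S m → m ∈ C) ∧ C.card ≤ k.factorial := by
  classical
  induction k using Nat.strong_induction_on with
  | _ k ih =>
    intro S hS
    have hlt : ∀ T : Flat n, S ⊂ T.1 → n - T.1.ncard < k := by
      intro T hT
      have h1 := Set.ncard_lt_ncard hT
      have h2 := Set.ncard_le_ncard (Set.subset_univ T.1)
      rw [Set.ncard_univ, Nat.card_fin] at h2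
      omega
    have hex : ∀ T : Flat n, ∃ C : Finset (Flat n →₀ ℕ), S ⊂ T.1 →
        (∀ m, NormalAbove T.1 m → m ∈ C) ∧ C.card ≤ (n - T.1.ncard).factorial := by
      intro T
      by_cases hT : S ⊂ T.1
      · obtain ⟨C, hC⟩ := ih _ (hlt T hT) T.1 rfl
        exact ⟨C, fun _ => hC⟩
      · exact ⟨∅, fun h => absurd h hT⟩
    choose C hC using hex
    refine ⟨{0} ∪ (Finset.univ.filter fun T : Flat n => S ⊂ T.1).biUnion fun T =>
      (C T ×ˢ Finset.Ico 1 (T.1.ncard - S.ncard)).image fun q => q.1 + Finsupp.single T q.2,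
      ?_, ?_⟩
    · intro m hm
      by_cases h0 : m = 0
      · simp [h0]
      obtain ⟨T, hT, hmT, ha⟩ := hm.exists_min h0
      refine Finset.mem_union_right _ (Finset.mem_biUnion.2 ⟨T, by simpa using hT, ?_⟩)
      refine Finset.mem_image.2 ⟨(m.erase T, m T), ?_, Finsupp.erase_add_single T m⟩
      exact Finset.mem_product.2 ⟨(hC T hT).1 _ hmT, ha⟩
    · refine (Finset.card_union_le _ _).trans ?_
      rw [Finset.card_singleton, ← sum_choose_mul_factorial]
      refine Nat.add_le_add_left ?_ _
      refine Finset.card_biUnion_le.trans ?_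
      subst hS
      refine le_trans ?_ (sum_ssuperset_le S fun j => (n - S.ncard - j).factorial * (j - 1))
      refine Finset.sum_le_sum fun T hT => ?_
      have hT' := (Finset.mem_filter.1 hT).2
      have h1 := Set.ncard_lt_ncard hT'
      refine Finset.card_image_le.trans ?_
      rw [Finset.card_product, Nat.card_Ico,
        show n - S.ncard - (T.1.ncard - S.ncard) = n - T.1.ncard by omega]
      exact Nat.mul_le_mul_right _ (hC T hT').2

theorem finite_isNormal (n : ℕ) : {m : Flat n →₀ ℕ | IsNormal m}.Finite := by
  obtain ⟨C, hC, -⟩ := exists_finset_normalAbove (n := n) _ ∅ rfl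
  exact C.finite_toSet.subset fun m hm => hC m hm.normalAbove

theorem ncard_isNormal_le (n : ℕ) : {m : Flat n →₀ ℕ | IsNormal m}.ncard ≤ n.factorial := by
  obtain ⟨C, hC, hcard⟩ := exists_finset_normalAbove (n := n) _ ∅ rfl
  have h := Set.ncard_le_ncard (s := {m : Flat n →₀ ℕ | IsNormal m}) (t := (C : Set _))
    (fun m hm => hC m hm.normalAbove) C.finite_toSet
  rw [Set.ncard_coe_finset] at h
  simpa using h.trans hcard

/-! ### Localization at complete flags -/

/-- The initial segments of the linear order of `Fin n` given by `w`. -/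
def flag {n : ℕ} (w : Equiv.Perm (Fin n)) (l : ℕ) : Set (Fin n) := w '' {i | i.val < l}

theorem flag_mono {n : ℕ} (w : Equiv.Perm (Fin n)) : Monotone (flag w) :=
  fun _ _ h => Set.image_mono fun _ hi => lt_of_lt_of_le hi h

theorem mem_flag {n : ℕ} (w : Equiv.Perm (Fin n)) (i : Fin n) (l : ℕ) :
    w i ∈ flag w l ↔ i.val < l := w.injective.mem_set_image

theorem ncard_flag {n : ℕ} (w : Equiv.Perm (Fin n)) {l : ℕ} (h : l ≤ n) :
    (flag w l).ncard = l := by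
  rw [flag, Set.ncard_image_of_injective _ w.injective]
  have : {i : Fin n | i.val < l} = Set.range (Fin.castLE h) := by
    ext i
    simp only [Set.mem_ofPred_eq, Set.mem_range]
    exact ⟨fun hi => ⟨⟨i, hi⟩, rfl⟩, by rintro ⟨j, rfl⟩; exact j.2⟩
  rw [this, ← Set.image_univ, Set.ncard_image_of_injective _ (Fin.castLE_injective h),
    Set.ncard_univ, Nat.card_fin]

/-- The variables listed in the order given by `w`, followed by zeros. -/
noncomputable def coord {n : ℕ} (w : Equiv.Perm (Fin n)) (i : ℕ) : MvPolynomial (Fin n) ℤ :=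
  if h : i < n then X (w ⟨i, h⟩) else 0

theorem coord_sub_ne_zero {n : ℕ} (w : Equiv.Perm (Fin n)) {i : ℕ} (h : i < n) :
    coord w i - coord w (i + 1) ≠ 0 := by
  rw [coord, coord, dif_pos h]
  split_ifs with h'
  · rw [sub_ne_zero]
    intro he
    have := w.injective (X_injective he)
    simp at this
  · rw [sub_zero]
    exact X_ne_zero _

open scoped Classical in
/-- The restriction of a generator to the torus fixed point given by `w`. -/
noncomputable def localGen {n : ℕ} (w : Equiv.Perm (Fin n)) (S : Flat n) :
    MvPolynomial (Fin n) ℤ :=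
  if S.1 = flag w S.1.ncard then coord w (S.1.ncard - 1) - coord w S.1.ncard else 0

/-- Localization of the Stanley–Reisner ring at the torus fixed points. -/
noncomputable def localization (n : ℕ) :
    MvPolynomial (Flat n) ℤ →ₐ[ℤ] (Equiv.Perm (Fin n) → MvPolynomial (Fin n) ℤ) :=
  aeval fun S w => localGen w S

theorem localization_X {n : ℕ} (S : Flat n) (w : Equiv.Perm (Fin n)) :
    localization n (X S) w = localGen w S := by
  rw [localization, aeval_X]

theorem localGen_mul_localGen {n : ℕ} (w : Equiv.Perm (Fin n)) {S T : Flat n}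
    (h : ¬ S.1 ⊆ T.1) (h' : ¬ T.1 ⊆ S.1) : localGen w S * localGen w T = 0 := by
  rw [localGen, localGen]
  split_ifs with h1 h2
  · exfalso
    rcases le_total S.1.ncard T.1.ncard with hl | hl
    · exact h (by rw [h1, h2]; exact flag_mono w hl)
    · exact h' (by rw [h1, h2]; exact flag_mono w hl)
  all_goals simp

/-- The members of a complete flag, as flats. -/
def flagFlat {n : ℕ} (w : Equiv.Perm (Fin n)) (i : Fin n) : Flat n :=
  ⟨flag w (i + 1), isFlat_uniformMatroid_self n _, w i, (mem_flag w i _).2 (Nat.lt_succ_self _)⟩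

theorem ncard_flagFlat {n : ℕ} (w : Equiv.Perm (Fin n)) (i : Fin n) :
    (flagFlat w i).1.ncard = i + 1 := ncard_flag w i.2

theorem localGen_flagFlat {n : ℕ} (w : Equiv.Perm (Fin n)) (i : Fin n) :
    localGen w (flagFlat w i) = coord w i - coord w (i + 1) := by
  rw [localGen, if_pos (by rw [ncard_flagFlat]; rfl), ncard_flagFlat, Nat.add_sub_cancel]

open scoped Classical in
-- If `e = w i`, the flag members containing `e` are those of size greater than `i`, and their
-- values telescope from `coord w i` to `coord w n = 0`.
theorem sum_localGen {n : ℕ} (w : Equiv.Perm (Fin n)) (e : Fin n) :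
    ∑ S : Flat n with e ∈ S.1, localGen w S = X e := by
  obtain ⟨i, rfl⟩ := w.surjective e
  have h1 : ∑ l ∈ Finset.range (n - i), (coord w (i + l) - coord w (i + l + 1)) = X (w i) := by
    have h := Finset.sum_range_sub' (fun l => coord w (i + l)) (n - i)
    simp only [← add_assoc] at h
    rw [h, show (i : ℕ) + (n - i) = n by omega]
    simp [coord]
  rw [← h1]
  symm
  refine Finset.sum_bij_ne_zero
    (fun l hl _ => flagFlat w ⟨i + l, by have := Finset.mem_range.1 hl; omega⟩) ?_ ?_ ?_ ?_
  · intro l hl _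
    simp only [Finset.mem_filter, Finset.mem_univ, true_and]
    exact (mem_flag w i _).2 (by simp only; omega)
  · intro l hl _ l' hl' _ h
    have h2 := congrArg (fun S : Flat n => S.1.ncard) h
    simp only [ncard_flagFlat] at h2
    omega
  · intro S hS hne
    have hflag : S.1 = flag w S.1.ncard := by
      by_contra hc
      exact hne (by rw [localGen, if_neg hc])
    have hmem := (Finset.mem_filter.1 hS).2
    rw [hflag, mem_flag] at hmem
    have hle := Set.ncard_le_ncard (Set.subset_univ S.1)
    rw [Set.ncard_univ, Nat.card_fin] at hle
    refine ⟨S.1.ncard - 1 - i, Finset.mem_range.2 (by omega), ?_, ?_⟩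
    · rw [show (i : ℕ) + (S.1.ncard - 1 - i) = S.1.ncard - 1 by omega]
      exact coord_sub_ne_zero w (by omega)
    · apply Subtype.ext
      refine Eq.trans ?_ hflag.symm
      change flag w (i + (S.1.ncard - 1 - i) + 1) = _
      rw [show (i : ℕ) + (S.1.ncard - 1 - i) + 1 = S.1.ncard by omega]
  · intro l hl _
    rw [localGen_flagFlat]

/-- A complete flag determines its permutation, so at any `w' ≠ w` some factor vanishes. These
elements show that the image has full rank `n!`. -/
theorem localization_prod_flag {n : ℕ} (w : Equiv.Perm (Fin n)) :
    ∃ g : MvPolynomial (Fin n) ℤ, g ≠ 0 ∧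
      localization n (∏ i, X (flagFlat w i)) = Pi.single w g := by
  classical
  refine ⟨∏ i : Fin n, (coord w i - coord w (i + 1)),
    Finset.prod_ne_zero_iff.2 fun i _ => coord_sub_ne_zero w i.2, ?_⟩
  funext w'
  rw [map_prod, Finset.prod_apply]
  simp only [localization_X]
  by_cases h : w' = w
  · subst h
    rw [Pi.single_eq_same]
    refine Finset.prod_congr rfl fun i _ => ?_
    rw [localGen_flagFlat]
  · rw [Pi.single_eq_of_ne h]
    by_contra hne
    rw [← Ne, Finset.prod_ne_zero_iff] at hne
    have hfl : ∀ l : ℕ, l ≤ n → flag w l = flag w' l := by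
      intro l hl
      rcases Nat.eq_zero_or_pos l with rfl | hpos
      · simp [flag]
      · have h1 := hne ⟨l - 1, by omega⟩ (Finset.mem_univ _)
        by_contra hc
        refine h1 ?_
        rw [localGen, ncard_flagFlat, if_neg]
        simp only [flagFlat]
        rwa [show l - 1 + 1 = l by omega]
    apply h
    ext1 i
    obtain ⟨j, hj⟩ := w.surjective (w' i)
    have h1 : ∀ l : ℕ, l ≤ n → (j.val < l ↔ i.val < l) := by
      intro l hl
      rw [← mem_flag w j, ← mem_flag w' i, hj, hfl l hl]
    have h2 := h1 (j + 1) j.2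
    have h3 := h1 (i + 1) i.2
    rw [← hj, show i = j from Fin.ext (by omega)]

/-- The image of the localization map is a module over the polynomial ring. -/
noncomputable def localRange (n : ℕ) :
    Submodule (MvPolynomial (Fin n) ℤ) (Equiv.Perm (Fin n) → MvPolynomial (Fin n) ℤ) where
  carrier := Set.range (localization n)
  add_mem' := by
    rintro _ _ ⟨p, rfl⟩ ⟨q, rfl⟩
    exact ⟨p + q, map_add _ _ _⟩
  zero_mem' := ⟨0, map_zero _⟩
  smul_mem' := by
    classical
    rintro g _ ⟨p, rfl⟩
    -- By `sum_localGen`, multiplication by `X e` is induced by the linear form `∑_{S ∋ e} X S`.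
    refine ⟨aeval (fun e => ∑ S : Flat n with e ∈ S.1, X S) g * p, ?_⟩
    have h : (localization n).comp (aeval (fun e => ∑ S : Flat n with e ∈ S.1, X S)) =
        Algebra.algHom ℤ (MvPolynomial (Fin n) ℤ) _ := by
      ext e w
      rw [AlgHom.comp_apply, aeval_X, map_sum, Finset.sum_apply]
      simp only [localization_X, sum_localGen]
      rfl
    rw [map_mul, Algebra.smul_def]
    congr 1
    exact DFunLike.congr_fun h g

theorem localization_mem (n : ℕ) (p : MvPolynomial (Flat n) ℤ) :
    localization n p ∈ localRange n := ⟨p, rfl⟩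

/-- Incomparable products localize to zero and the linear relation at `e` localizes to `X e`, so
passing to the Chow ring amounts to reducing the image modulo the ideal of the origin. -/
theorem localization_mem_smul {n : ℕ} {p : MvPolynomial (Flat n) ℤ}
    (hp : p ∈ chowIdeal (uniformMatroid n n)) :
    localization n p ∈ RingHom.ker (constantCoeff (R := ℤ) (σ := Fin n)) • localRange n := by
  classical
  induction hp using Submodule.span_induction with
  | mem p hp =>
    rcases hp with ⟨S, T, h, h', rfl⟩ | ⟨e, -, rfl⟩
    · have h0 : localization n (X S * X T) = 0 := by
        funext w
        rw [map_mul, Pi.mul_apply, localization_X, localization_X, localGen_mul_localGen w h h']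
        rfl
      rw [h0]
      exact Submodule.zero_mem _
    · have h1 : localization n (∑ S : Flat n with e ∈ S.1, X S) =
          (X e : MvPolynomial (Fin n) ℤ) • localization n 1 := by
        funext w
        rw [map_sum, Finset.sum_apply]
        simp only [localization_X, sum_localGen]
        simp
      convert Submodule.smul_mem_smul (I := RingHom.ker (constantCoeff (R := ℤ) (σ := Fin n)))
        (r := X e) (by simp [RingHom.mem_ker]) (localization_mem n 1) using 1
  | zero => rw [map_zero]; exact Submodule.zero_mem _
  | add p q _ _ hp hq => rw [map_add]; exact Submodule.add_mem _ hp hq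
  | smul a p _ hp =>
    rw [smul_eq_mul, map_mul]
    refine Submodule.smul_induction_on hp ?_ ?_
    · rintro r hr _ ⟨q, rfl⟩
      rw [mul_smul_comm, ← map_mul]
      exact Submodule.smul_mem_smul hr (localization_mem n _)
    · intro y z hy hz
      rw [mul_add]
      exact Submodule.add_mem _ hy hz

/-! ### Linear independence by Nakayama's lemma -/

/-- The exponent vectors of the Feichtner–Yuzvinsky basis. -/
abbrev Normal (n : ℕ) : Type := {m : Flat n →₀ ℕ // IsNormal m}

noncomputable instance (n : ℕ) : Fintype (Normal n) := (finite_isNormal n).fintype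

theorem card_normal_le (n : ℕ) : Fintype.card (Normal n) ≤ n.factorial := by
  rw [← Nat.card_eq_fintype_card]
  exact ncard_isNormal_le n

theorem top_le_span_normal (n : ℕ) :
    ⊤ ≤ Submodule.span ℤ (Set.range fun m : Normal n => mon m.1) := by
  rw [← span_normal_eq_top n]
  refine Submodule.span_mono ?_
  rintro _ ⟨m, hm, rfl⟩
  exact ⟨⟨m, hm⟩, rfl⟩

/-- The localizations of the Feichtner–Yuzvinsky monomials. -/
noncomputable def localMon {n : ℕ} (m : Normal n) : Equiv.Perm (Fin n) → MvPolynomial (Fin n) ℤ :=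
  localization n (monomial m.1 1)

theorem localization_sum {n : ℕ} (c : Normal n → ℤ) :
    localization n (∑ m, c m • monomial m.1 1) =
      ∑ m, (C (c m) : MvPolynomial (Fin n) ℤ) • localMon m := by
  rw [map_sum]
  refine Finset.sum_congr rfl fun m _ => ?_
  rw [map_zsmul, localMon, MvPolynomial.C_eq_smul_one, smul_one_smul]

theorem localRange_le (n : ℕ) :
    localRange n ≤ Submodule.span (MvPolynomial (Fin n) ℤ) (Set.range (localMon (n := n))) ⊔
      RingHom.ker (constantCoeff (R := ℤ) (σ := Fin n)) • localRange n := by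
  rintro _ ⟨p, rfl⟩
  obtain ⟨c, hc⟩ := (Submodule.mem_span_range_iff_exists_fun ℤ).1
    (top_le_span_normal n (Submodule.mem_top (x := Ideal.Quotient.mk _ p)))
  have hmem : p - ∑ m, c m • monomial m.1 1 ∈ chowIdeal (uniformMatroid n n) := by
    rw [← Ideal.Quotient.mk_eq_mk_iff_sub_mem, ← hc, map_sum]
    refine Finset.sum_congr rfl fun m _ => ?_
    rw [map_zsmul]
    rfl
  have h := localization_mem_smul hmem
  rw [map_sub, localization_sum] at h
  refine Submodule.mem_sup.2 ⟨_, ?_, _, h, add_sub_cancel _ _⟩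
  exact Submodule.sum_mem _ fun m _ => Submodule.smul_mem _ _ (Submodule.subset_span ⟨m, rfl⟩)

open scoped Pointwise in
theorem exists_smul_localRange_le (n : ℕ) : ∃ r : MvPolynomial (Fin n) ℤ, constantCoeff r = 1 ∧
    ∀ y ∈ localRange n,
      r • y ∈ Submodule.span (MvPolynomial (Fin n) ℤ) (Set.range (localMon (n := n))) := by
  obtain ⟨r, hr, h⟩ := Submodule.exists_sub_one_mem_and_smul_le_of_fg_of_le_sup
    (IsNoetherian.noetherian (localRange n)) le_rfl (localRange_le n)
  refine ⟨r, ?_, fun y hy => h (Submodule.smul_mem_pointwise_smul y r _ hy)⟩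
  rwa [RingHom.mem_ker, map_sub, map_one, sub_eq_zero] at hr

/-- The localizations of the Feichtner–Yuzvinsky monomials, with values in rational functions. -/
noncomputable def fracMon {n : ℕ} (m : Normal n) :
    Equiv.Perm (Fin n) → FractionRing (MvPolynomial (Fin n) ℤ) :=
  (Algebra.linearMap (MvPolynomial (Fin n) ℤ) (FractionRing (MvPolynomial (Fin n) ℤ))).compLeft
    (Equiv.Perm (Fin n)) (localMon m)

/-- Each standard basis vector, scaled by the nonzero `r * g`, lies in the span. So at most `n!`
vectors span a space of dimension `n!`, and they must be independent. -/
theorem linearIndependent_fracMon (n : ℕ) :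
    LinearIndependent (FractionRing (MvPolynomial (Fin n) ℤ)) (fracMon (n := n)) := by
  classical
  refine linearIndependent_of_top_le_span_of_card_le_finrank ?_ ?_
  · set K := FractionRing (MvPolynomial (Fin n) ℤ)
    set L := (Algebra.linearMap (MvPolynomial (Fin n) ℤ) K).compLeft (Equiv.Perm (Fin n)) with hL
    have hspan : ∀ y ∈ Submodule.span (MvPolynomial (Fin n) ℤ) (Set.range (localMon (n := n))),
        L y ∈ Submodule.span K (Set.range (fracMon (n := n))) := by
      intro y hy
      have h1 := Submodule.mem_map_of_mem (f := L) hy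
      rw [Submodule.map_span, ← Set.range_comp] at h1
      exact Submodule.span_le_restrictScalars (MvPolynomial (Fin n) ℤ) K _ h1
    obtain ⟨r, hr, hrN⟩ := exists_smul_localRange_le n
    have hr0 : r ≠ 0 := by
      rintro rfl
      simp at hr
    rw [← (Pi.basisFun K (Equiv.Perm (Fin n))).span_eq, Submodule.span_le]
    rintro _ ⟨w, rfl⟩
    obtain ⟨g, hg, hgw⟩ := localization_prod_flag w
    have h2 := hspan _ (hrN _ (localization_mem n (∏ i, X (flagFlat w i))))
    have h3 : L (r • localization n (∏ i, X (flagFlat w i))) =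
        algebraMap _ K (r * g) • Pi.basisFun K (Equiv.Perm (Fin n)) w := by
      rw [hgw]
      funext w'
      by_cases h : w' = w
      · subst h
        simp [hL]
      · simp [hL, Pi.single_eq_of_ne h]
    rw [h3] at h2
    refine (Submodule.smul_mem_iff _ ?_).1 h2
    rw [Ne, FaithfulSMul.algebraMap_eq_zero_iff]
    exact mul_ne_zero hr0 hg
  · rw [Module.finrank_fintype_fun_eq_card, Fintype.card_perm, Fintype.card_fin]
    exact card_normal_le n

theorem linearIndependent_localMon (n : ℕ) :
    LinearIndependent (MvPolynomial (Fin n) ℤ) (localMon (n := n)) := by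
  refine LinearIndependent.of_comp ((Algebra.linearMap (MvPolynomial (Fin n) ℤ)
    (FractionRing (MvPolynomial (Fin n) ℤ))).compLeft (Equiv.Perm (Fin n))) ?_
  refine (linearIndependent_fracMon n).restrict_scalars ?_
  intro a b h
  simpa [Algebra.smul_def] using h

/-- An integer relation localizes into the maximal-ideal multiple of `localRange`; multiplying by
`r` moves it into that multiple of the span of `localMon`. Comparing coefficients puts each `r * C
(c m)` in the ideal of the origin, and `r` has constant term `1`, so `c m = 0`. -/
theorem linearIndependent_normal (n : ℕ) :
    LinearIndependent ℤ fun m : Normal n => mon m.1 := by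
  rw [Fintype.linearIndependent_iff]
  intro c hc
  have hmem : ∑ m, c m • monomial m.1 1 ∈ chowIdeal (uniformMatroid n n) := by
    rw [← Ideal.Quotient.eq_zero_iff_mem, ← hc, map_sum]
    refine Finset.sum_congr rfl fun m _ => ?_
    rw [map_zsmul]
    rfl
  have h := localization_mem_smul hmem
  rw [localization_sum] at h
  obtain ⟨r, hr, hrN⟩ := exists_smul_localRange_le n
  have h1 : r • ∑ m, (C (c m) : MvPolynomial (Fin n) ℤ) • localMon m ∈
      RingHom.ker (constantCoeff (R := ℤ) (σ := Fin n)) •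
        Submodule.span (MvPolynomial (Fin n) ℤ) (Set.range (localMon (n := n))) := by
    refine Submodule.smul_induction_on h ?_ ?_
    · intro j hj y hy
      rw [smul_comm]
      exact Submodule.smul_mem_smul hj (hrN y hy)
    · intro y z hy hz
      rw [smul_add]
      exact Submodule.add_mem _ hy hz
  rw [Submodule.mem_ideal_smul_span_iff_exists_sum] at h1
  obtain ⟨a, ha, hsum⟩ := h1
  rw [Finsupp.sum_fintype _ _ (by simp), Finset.smul_sum] at hsum
  simp only [smul_smul] at hsum
  intro m
  have h2 := ((linearIndependent_localMon n).fintypeLinearCombination_injective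
    (a₁ := fun m => a m) (a₂ := fun m => r * C (c m))
    (by simpa [Fintype.linearCombination_apply] using hsum))
  have h3 := congrArg constantCoeff (congrFun h2 m)
  have h4 := ha m
  rw [RingHom.mem_ker] at h4
  simpa [h4, hr] using h3.symm

/-- The Feichtner–Yuzvinsky basis of the permutohedral Chow ring. -/
noncomputable def normalBasis (n : ℕ) : Module.Basis (Normal n) ℤ (PermutohedralChowRing n) :=
  Module.Basis.mk (linearIndependent_normal n) (top_le_span_normal n)

theorem normalBasis_apply {n : ℕ} (m : Normal n) : normalBasis n m = mon m.1 := by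
  rw [normalBasis, Module.Basis.mk_apply]

/-! ### The symmetric group action on the basis -/

theorem smul_mon {n : ℕ} (σ : Equiv.Perm (Fin n)) (m : Flat n →₀ ℕ) :
    σ • mon m = mon (m.mapDomain (permFlat σ)) := by
  change permHom σ (Ideal.Quotient.mk _ _) = _
  rw [permHom_mk, rename_monomial]
  rfl

theorem permFlat_injective {n : ℕ} (σ : Equiv.Perm (Fin n)) :
    Function.Injective (permFlat (n := n) σ) := fun _ _ h =>
  Subtype.ext (σ.injective.image_injective (congrArg Subtype.val h))

theorem ncard_permFlat {n : ℕ} (σ : Equiv.Perm (Fin n)) (S : Flat n) :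
    (permFlat σ S).1.ncard = S.1.ncard := Set.ncard_image_of_injective _ σ.injective

theorem permFlat_subset_iff {n : ℕ} (σ : Equiv.Perm (Fin n)) {S T : Flat n} :
    (permFlat σ S).1 ⊆ (permFlat σ T).1 ↔ S.1 ⊆ T.1 := Set.image_subset_image_iff σ.injective

theorem IsNormal.mapDomain {n : ℕ} (σ : Equiv.Perm (Fin n)) {m : Flat n →₀ ℕ} (h : IsNormal m) :
    IsNormal (m.mapDomain (permFlat σ)) := by
  classical
  have hsupp := Finsupp.mapDomain_support_of_injective (permFlat_injective σ) m
  obtain ⟨h1, h2, h3⟩ := h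
  refine ⟨?_, ?_, ?_⟩
  · rw [ChainSupp, hsupp]
    simp only [Finset.forall_mem_image, permFlat_subset_iff]
    exact h1
  · rw [hsupp]
    simp only [Finset.forall_mem_image, ncard_permFlat,
      Finsupp.mapDomain_apply (permFlat_injective σ)]
    exact h2
  · rw [hsupp]
    simp only [Finset.forall_mem_image, ncard_permFlat, ssubset_iff_subset_not_subset,
      permFlat_subset_iff, Finsupp.mapDomain_apply (permFlat_injective σ)]
    exact h3

theorem normalBasis_repr_smul {n : ℕ} (σ : Equiv.Perm (Fin n)) {m m' : Normal n}
    (h : m.1.mapDomain (permFlat σ) = m'.1) (f : PermutohedralChowRing n) :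
    (normalBasis n).repr (σ • f) m' = (normalBasis n).repr f m := by
  classical
  let φ : PermutohedralChowRing n →ₗ[ℤ] ℤ := (normalBasis n).coord m' ∘ₗ
    (permHom σ).toAddMonoidHom.toIntLinearMap
  have hφ : φ = (normalBasis n).coord m := by
    refine (normalBasis n).ext fun k => ?_
    change (normalBasis n).repr (σ • normalBasis n k) m' = (normalBasis n).repr (normalBasis n k) m
    rw [normalBasis_apply, smul_mon, ← normalBasis_apply ⟨_, k.2.mapDomain σ⟩, ← normalBasis_apply,
      Module.Basis.repr_self, Module.Basis.repr_self, Finsupp.single_apply, Finsupp.single_apply]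
    congr 1
    rw [eq_iff_iff, Subtype.ext_iff, Subtype.ext_iff, ← h]
    exact (Finsupp.mapDomain_injective (permFlat_injective σ)).eq_iff
  exact LinearMap.congr_fun hφ f

/-- The exponents of a monomial, recorded at the cardinalities of the subsets. -/
noncomputable def cardType {n : ℕ} (m : Flat n →₀ ℕ) : ℕ →₀ ℕ :=
  m.mapDomain fun S => S.1.ncard

theorem ChainSupp.injOn {n : ℕ} {m : Flat n →₀ ℕ} (h : ChainSupp m) :
    Set.InjOn (fun S : Flat n => S.1.ncard) (m.support : Set (Flat n)) := by
  intro S hS T hT hST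
  apply Subtype.ext
  rcases h S hS T hT with h | h
  · exact Set.eq_of_subset_of_ncard_le h hST.ge
  · exact (Set.eq_of_subset_of_ncard_le h hST.le).symm

theorem ChainSupp.cardType_apply {n : ℕ} {m : Flat n →₀ ℕ} (h : ChainSupp m) {S : Flat n}
    (hS : S ∈ m.support) : cardType m S.1.ncard = m S :=
  Finsupp.mapDomain_apply' (m.support : Set (Flat n)) m subset_rfl h.injOn hS

theorem ChainSupp.exists_flag {n : ℕ} {m : Flat n →₀ ℕ} (h : ChainSupp m) :
    ∃ w : Equiv.Perm (Fin n), ∀ S ∈ m.support, S.1 = flag w S.1.ncard := by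
  classical
  -- Sort the elements by how many members of the chain miss them; every member then becomes an
  -- initial segment.
  let u : Fin n → ℕ := fun e => (m.support.filter fun S => e ∉ S.1).card
  refine ⟨Tuple.sort u, fun S hS => ?_⟩
  set w := Tuple.sort u
  have hmono : Monotone (u ∘ w) := Tuple.monotone_sort u
  have hlow : ∀ i j, j ≤ i → w i ∈ S.1 → w j ∈ S.1 := by
    intro i j hji hi
    by_contra hj
    -- Every member missing `w i` also misses `w j`, while `S` misses only `w j`: the count would
    -- strictly drop from `j` to `i`.
    refine (hmono hji).not_gt (Finset.card_lt_card ⟨?_, fun hsub => ?_⟩)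
    · intro T hT
      rw [Finset.mem_filter] at hT ⊢
      refine ⟨hT.1, fun hjT => ?_⟩
      rcases h S hS T hT.1 with h' | h'
      · exact hT.2 (h' hi)
      · exact hj (h' hjT)
    · exact (Finset.mem_filter.1 (hsub (Finset.mem_filter.2 ⟨hS, hj⟩))).2 hi
  have hcard : S.1.ncard ≤ n := by
    simpa using Set.ncard_le_ncard (Set.subset_univ S.1)
  refine Set.eq_of_subset_of_ncard_le (fun e he => ?_) (ncard_flag w hcard).le
  obtain ⟨i, rfl⟩ := w.surjective e
  rw [mem_flag]
  have hsub : flag w (i + 1) ⊆ S.1 := by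
    rintro _ ⟨j, hj, rfl⟩
    exact hlow i j (Nat.lt_succ_iff.1 hj) he
  have := Set.ncard_le_ncard hsub
  rw [ncard_flag w i.2] at this
  omega

/-- Extend both chains to complete flags `w` and `w'`; then `w' * w⁻¹` carries each segment of the
first to the segment of the same size in the second. -/
theorem exists_perm_mapDomain {n : ℕ} {m m' : Flat n →₀ ℕ} (h : ChainSupp m) (h' : ChainSupp m')
    (heq : cardType m = cardType m') :
    ∃ σ : Equiv.Perm (Fin n), m.mapDomain (permFlat σ) = m' := by
  obtain ⟨w, hw⟩ := h.exists_flag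
  obtain ⟨w', hw'⟩ := h'.exists_flag
  refine ⟨w' * w⁻¹, Finsupp.mapDomain_injective Subtype.val_injective ?_⟩
  have h1 : m.mapDomain (fun S => (permFlat (w' * w⁻¹) S).1) =
      m.mapDomain (fun S => flag w' S.1.ncard) := by
    refine Finsupp.mapDomain_congr fun S hS => ?_
    change (w' * w⁻¹) '' S.1 = _
    conv_lhs => rw [hw S hS]
    rw [flag, flag, Set.image_image]
    simp
  have h2 : m'.mapDomain Subtype.val = m'.mapDomain (fun S => flag w' S.1.ncard) :=
    Finsupp.mapDomain_congr fun S hS => hw' S hS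
  rw [← Finsupp.mapDomain_comp, h2]
  refine h1.trans ?_
  have h3 := congrArg (Finsupp.mapDomain (flag w')) heq
  rwa [cardType, cardType, ← Finsupp.mapDomain_comp, ← Finsupp.mapDomain_comp] at h3

/-! ### Orbit sums as products of the `z_l` -/

theorem sum_pow_of_pairwise_mul_eq_zero {R ι : Type*} [CommRing R] (s : Finset ι) (f : ι → R)
    (h : ∀ i ∈ s, ∀ j ∈ s, i ≠ j → f i * f j = 0) (a : ℕ) :
    (∑ i ∈ s, f i) ^ (a + 1) = ∑ i ∈ s, f i ^ (a + 1) := by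
  induction a with
  | zero => simp
  | succ a ih =>
    rw [pow_succ, ih, Finset.sum_mul_sum]
    refine Finset.sum_congr rfl fun i hi => ?_
    rw [Finset.sum_eq_single_of_mem i hi, ← pow_succ]
    intro j hj hji
    rw [pow_succ, mul_assoc, h i hi j hj hji.symm, mul_zero]

open scoped Classical in
theorem z_eq_sum_gen (n l : ℕ) : z n l = ∑ S : Flat n with S.1.ncard = l, gen S := by
  rw [z]
  refine Finset.sum_bij (fun S _ => ⟨S.1, isFlat_uniformMatroid_self n S.1, S.2.1⟩) ?_ ?_ ?_ ?_
  · intro S _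
    simpa using S.2.2
  · intro S _ T _ h
    exact Subtype.ext (congrArg (fun U : Flat n => U.1) h)
  · intro S hS
    exact ⟨⟨S.1, S.2.2, (Finset.mem_filter.1 hS).2⟩, Finset.mem_univ _, rfl⟩
  · intro S _
    exact x_eq_gen _ _

open scoped Classical in
theorem z_pow (n l : ℕ) {a : ℕ} (ha : a ≠ 0) :
    z n l ^ a = ∑ S : Flat n with S.1.ncard = l, gen S ^ a := by
  obtain ⟨a, rfl⟩ := Nat.exists_eq_succ_of_ne_zero ha
  rw [z_eq_sum_gen]
  refine sum_pow_of_pairwise_mul_eq_zero _ _ (fun S hS T hT hne => ?_) a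
  have h1 : S.1.ncard = T.1.ncard := by
    rw [(Finset.mem_filter.1 hS).2, (Finset.mem_filter.1 hT).2]
  refine gen_mul_gen (fun h => hne ?_) (fun h => hne ?_)
  · exact Subtype.ext (Set.eq_of_subset_of_ncard_le h h1.ge)
  · exact Subtype.ext (Set.eq_of_subset_of_ncard_le h h1.le).symm

/-- The exponent vector with exponents `τ` at a choice of subsets. -/
noncomputable def ofChoice {n : ℕ} (τ : ℕ →₀ ℕ) (p : τ.support → Flat n) : Flat n →₀ ℕ :=
  ∑ i, Finsupp.single (p i) (τ i)

theorem mon_ofChoice {n : ℕ} (τ : ℕ →₀ ℕ) (p : τ.support → Flat n) :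
    mon (ofChoice τ p) = ∏ i, gen (p i) ^ τ i := by
  classical
  have h : ∀ s : Finset τ.support, mon (∑ i ∈ s, Finsupp.single (p i) (τ i)) =
      ∏ i ∈ s, gen (p i) ^ τ i := by
    intro s
    induction s using Finset.induction_on with
    | empty => simp [mon_zero]
    | insert i s hi ih =>
      rw [Finset.sum_insert hi, Finset.prod_insert hi, mon_add, ih, mon_single]
  exact h _

theorem cardType_ofChoice {n : ℕ} {τ : ℕ →₀ ℕ} {p : τ.support → Flat n}
    (hp : ∀ i, (p i).1.ncard = i) : cardType (ofChoice τ p) = τ := by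
  rw [cardType, ofChoice, Finsupp.mapDomain_finsetSum]
  simp only [Finsupp.mapDomain_single, hp]
  rw [Finset.sum_coe_sort τ.support fun i => Finsupp.single i (τ i)]
  exact τ.sum_single

theorem ofChoice_apply {n : ℕ} {τ : ℕ →₀ ℕ} {p : τ.support → Flat n}
    (hp : ∀ i, (p i).1.ncard = i) (i : τ.support) : ofChoice τ p (p i) = τ i := by
  classical
  rw [ofChoice, Finsupp.finsetSum_apply, Finset.sum_eq_single i]
  · simp
  · intro j _ hji
    refine Finsupp.single_eq_of_ne fun h => hji (Subtype.ext ?_)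
    rw [← hp j, ← hp i, h]
  · simp

theorem ofChoice_apply_eq_zero {n : ℕ} {τ : ℕ →₀ ℕ} {p : τ.support → Flat n} {S : Flat n}
    (h : ∀ i, p i ≠ S) : ofChoice τ p S = 0 := by
  classical
  rw [ofChoice, Finsupp.finsetSum_apply]
  exact Finset.sum_eq_zero fun i _ => Finsupp.single_eq_of_ne (h i).symm

theorem ofChoice_injective {n : ℕ} {τ : ℕ →₀ ℕ} {p q : τ.support → Flat n}
    (hp : ∀ i, (p i).1.ncard = i) (hq : ∀ i, (q i).1.ncard = i)
    (h : ofChoice τ p = ofChoice τ q) : p = q := by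
  funext i
  by_contra hne
  have h1 := ofChoice_apply hp i
  rw [h, ofChoice_apply_eq_zero] at h1
  · exact Finsupp.mem_support_iff.1 i.2 h1.symm
  · intro j hj
    have : j = i := Subtype.ext (by rw [← hp i, ← hq j, hj])
    subst this
    exact hne hj.symm

theorem ChainSupp.exists_ofChoice {n : ℕ} {m : Flat n →₀ ℕ} (h : ChainSupp m) {τ : ℕ →₀ ℕ}
    (hτ : cardType m = τ) :
    ∃ p : τ.support → Flat n, (∀ i, (p i).1.ncard = i) ∧ ofChoice τ p = m := by
  classical
  subst hτ
  have hex : ∀ i : (cardType m).support, ∃ S ∈ m.support, S.1.ncard = i := by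
    intro i
    simpa using Finset.mem_image.1 (Finsupp.mapDomain_support i.2)
  choose p hp hpc using hex
  refine ⟨p, hpc, Finsupp.ext fun S => ?_⟩
  by_cases hS : S ∈ m.support
  · have hi : S.1.ncard ∈ (cardType m).support := by
      rw [Finsupp.mem_support_iff, h.cardType_apply hS]
      exact Finsupp.mem_support_iff.1 hS
    have hpS : p ⟨_, hi⟩ = S := h.injOn (hp _) hS (hpc _)
    have h1 := ofChoice_apply hpc ⟨_, hi⟩
    rw [hpS] at h1
    exact h1.trans (h.cardType_apply hS)
  · rw [Finsupp.notMem_support_iff.1 hS]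
    exact ofChoice_apply_eq_zero fun i hi => hS (hi ▸ hp i)

open scoped Classical in
-- Expanding gives one monomial per choice of a set of each size. Choices that are not chains
-- vanish; a chain has the same type as `k`, hence is a translate of `k` and again normal.
theorem prod_z_pow {n : ℕ} (k : Normal n) :
    ∏ i : (cardType k.1).support, z n i ^ cardType k.1 i =
      ∑ m : Normal n with cardType m.1 = cardType k.1, mon m.1 := by
  set τ := cardType k.1 with hτ
  have h1 : ∀ i : τ.support, z n i ^ τ i = ∑ S : Flat n with S.1.ncard = (i : ℕ), gen S ^ τ i :=
    fun i => z_pow n i (Finsupp.mem_support_iff.1 i.2)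
  rw [Finset.prod_congr rfl fun i _ => h1 i, Finset.prod_univ_sum]
  symm
  have hmem : ∀ p : τ.support → Flat n, p ∈ Fintype.piFinset
      (fun i : τ.support => Finset.univ.filter fun S : Flat n => S.1.ncard = (i : ℕ)) ↔
      ∀ i, (p i).1.ncard = i := by
    intro p
    simp [Fintype.mem_piFinset]
  have hinj : Set.InjOn (ofChoice τ) (Fintype.piFinset
      (fun i : τ.support => Finset.univ.filter fun S : Flat n => S.1.ncard = (i : ℕ)) :
        Set (τ.support → Flat n)) := by
    intro p hp q hq h
    exact ofChoice_injective ((hmem p).1 hp) ((hmem q).1 hq) h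
  rw [Finset.sum_congr rfl fun p _ => (mon_ofChoice τ p).symm, ← Finset.sum_image hinj,
    ← Finset.sum_image (f := mon) (g := fun m : Normal n => m.1) Subtype.val_injective.injOn]
  refine Finset.sum_subset ?_ ?_
  · intro m hm
    obtain ⟨m', hm', rfl⟩ := Finset.mem_image.1 hm
    obtain ⟨p, hp, hpm⟩ := m'.2.1.exists_ofChoice (Finset.mem_filter.1 hm').2
    exact Finset.mem_image.2 ⟨p, (hmem p).2 hp, hpm⟩
  · intro m hm hm'
    obtain ⟨p, hp, rfl⟩ := Finset.mem_image.1 hm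
    refine mon_eq_zero fun hch => hm' ?_
    have htype := cardType_ofChoice ((hmem p).1 hp)
    obtain ⟨σ, hσ⟩ := exists_perm_mapDomain k.2.1 hch htype.symm
    have hnorm : IsNormal (ofChoice τ p) := hσ ▸ k.2.mapDomain σ
    exact Finset.mem_image.2 ⟨⟨_, hnorm⟩, Finset.mem_filter.2 ⟨Finset.mem_univ _, htype⟩, rfl⟩

theorem z_mem_closure (n l : ℕ) :
    z n l ∈ Subring.closure {f | ∃ l : ℕ, 1 ≤ l ∧ l ≤ n ∧ f = z n l} := by
  classical
  by_cases h : 1 ≤ l ∧ l ≤ n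
  · exact Subring.subset_closure ⟨l, h.1, h.2, rfl⟩
  · rw [z_eq_sum_gen, Finset.filter_false_of_mem, Finset.sum_empty]
    · exact Subring.zero_mem _
    · rintro S - rfl
      refine h ⟨(Set.ncard_pos (Set.toFinite _)).2 S.2.2, ?_⟩
      simpa using Set.ncard_le_ncard (Set.subset_univ S.1)

/-- The basis coefficients of an invariant are constant on orbits, so grouping them by `cardType`
leaves multiples of the products in `prod_z_pow`. -/
theorem fixedPoints_le_closure (n : ℕ) :
    FixedPoints.subring (PermutohedralChowRing n) (Equiv.Perm (Fin n)) ≤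
      Subring.closure {f | ∃ l : ℕ, 1 ≤ l ∧ l ≤ n ∧ f = z n l} := by
  classical
  intro f hf
  have hc : ∀ m k : Normal n, cardType m.1 = cardType k.1 →
      (normalBasis n).repr f m = (normalBasis n).repr f k := by
    intro m k hmk
    obtain ⟨σ, hσ⟩ := exists_perm_mapDomain m.2.1 k.2.1 hmk
    rw [← normalBasis_repr_smul σ hσ f, hf σ]
  rw [← (normalBasis n).sum_repr f, ← Finset.sum_fiberwise_of_maps_to
    (fun m (_ : m ∈ Finset.univ) => Finset.mem_image_of_mem (fun m : Normal n => cardType m.1)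
      (Finset.mem_univ m))]
  refine Subring.sum_mem _ fun τ hτ => ?_
  obtain ⟨k, -, rfl⟩ := Finset.mem_image.1 hτ
  have h1 : ∑ m : Normal n with cardType m.1 = cardType k.1,
      (normalBasis n).repr f m • normalBasis n m =
      (normalBasis n).repr f k • ∑ m : Normal n with cardType m.1 = cardType k.1, mon m.1 := by
    rw [Finset.smul_sum]
    refine Finset.sum_congr rfl fun m hm => ?_
    rw [normalBasis_apply, hc m k (Finset.mem_filter.1 hm).2]
  rw [h1, ← prod_z_pow]
  exact Subring.zsmul_mem _
    (Subring.prod_mem _ fun i _ => Subring.pow_mem _ (z_mem_closure n _) _) _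

theorem smul_z {n : ℕ} (σ : Equiv.Perm (Fin n)) (l : ℕ) : σ • z n l = z n l := by
  classical
  rw [z_eq_sum_gen, Finset.smul_sum]
  refine Finset.sum_bij (fun S _ => permFlat σ S) ?_ ?_ ?_ ?_
  · intro S hS
    simpa [ncard_permFlat] using hS
  · exact fun S _ T _ h => permFlat_injective σ h
  · intro S hS
    refine ⟨permFlat σ⁻¹ S, by simpa [ncard_permFlat] using hS, ?_⟩
    rw [← permFlat_mul, mul_inv_cancel, permFlat_one]
  · intro S _
    rw [gen, smul_mon, Finsupp.mapDomain_single]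
    rfl

theorem closure_z_eq_fixedPoints (n : ℕ) :
    Subring.closure {f | ∃ l : ℕ, 1 ≤ l ∧ l ≤ n ∧ f = z n l} =
      FixedPoints.subring (PermutohedralChowRing n) (Equiv.Perm (Fin n)) := by
  refine le_antisymm (Subring.closure_le.2 ?_) (fixedPoints_le_closure n)
  rintro _ ⟨l, -, -, rfl⟩ σ
  exact smul_z σ l

/-! ### Rank and nullity in uniform matroids -/

theorem rank_uniformMatroid {n : ℕ} (r : ℕ) (S : Set (Fin n)) :
    rank (uniformMatroid r n) S = min r S.ncard := by
  obtain ⟨I, hI⟩ := (uniformMatroid r n).exists_isBasis S (Set.subset_univ _)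
  have h1 : I.ncard ≤ r := hI.indep
  have h2 := Set.ncard_le_ncard hI.subset
  have h3 : rank (uniformMatroid r n) S = I.ncard := by
    rw [rank, ← hI.encard_eq_eRk, Set.ncard]
  rw [h3]
  refine le_antisymm (le_min h1 h2) ?_
  by_contra! hlt
  obtain ⟨e, heS, heI⟩ := Set.exists_mem_notMem_of_ncard_lt_ncard (hlt.trans_le (min_le_right _ _))
  have hind : (uniformMatroid r n).Indep (insert e I) := by
    rw [uniformMatroid_indep, Set.ncard_insert_of_notMem heI]
    exact hlt.trans_le (min_le_left _ _)
  have := hI.eq_of_subset_indep hind (Set.subset_insert e I) (Set.insert_subset heS hI.subset)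
  exact heI (this ▸ Set.mem_insert e I)

theorem y_uniformMatroid_eq_z {n r i j : ℕ} (h : i = min r (i + j)) :
    y (uniformMatroid r n) i j = z n (i + j) := by
  classical
  rw [y, z]
  refine Fintype.sum_equiv (Equiv.subtypeEquivRight fun S => ?_) _ _ fun S => rfl
  rw [nullity, rank_uniformMatroid]
  refine and_congr_right fun _ => ?_
  omega

theorem y_uniformMatroid_eq_zero {n r i j : ℕ} (h : i ≠ min r (i + j)) :
    y (uniformMatroid r n) i j = 0 := by
  rw [y]
  refine Finset.sum_eq_zero fun S _ => absurd S.2.2 ?_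
  rw [nullity, rank_uniformMatroid]
  omega

theorem rankNullityRing_uniformMatroid (r n : ℕ) (hrn : r ≤ n) :
    rankNullityRing (uniformMatroid r n) =
      Subring.closure {f | ∃ l : ℕ, 1 ≤ l ∧ l ≤ n ∧ f = z n l} := by
  refine le_antisymm (Subring.closure_le.2 ?_) (Subring.closure_le.2 ?_)
  · rintro _ ⟨i, j, -, -, rfl⟩
    by_cases h : i = min r (i + j)
    · rw [y_uniformMatroid_eq_z h]
      exact z_mem_closure n _
    · rw [y_uniformMatroid_eq_zero h]
      exact Subring.zero_mem _
  · rintro _ ⟨l, -, hl, rfl⟩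
    -- The rank and nullity of any set of size `l`.
    refine Subring.subset_closure ⟨min r l, l - min r l, by omega, by omega, ?_⟩
    rw [y_uniformMatroid_eq_z (by omega), show min r l + (l - min r l) = l by omega]

end RankNullity

theorem mainTheorem3 (r n : ℕ) (hrn : r ≤ n) :
    RankNullity.rankNullityRing (RankNullity.uniformMatroid r n) =
        FixedPoints.subring (RankNullity.PermutohedralChowRing n) (Equiv.Perm (Fin n)) ∧
      RankNullity.rankNullityRing (RankNullity.uniformMatroid r n) =
        Subring.closure {f | ∃ l : ℕ, 1 ≤ l ∧ l ≤ n ∧ f = RankNullity.z n l} := by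
  rw [RankNullity.rankNullityRing_uniformMatroid r n hrn]
  exact ⟨RankNullity.closure_z_eq_fixedPoints n, rfl⟩
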